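/- Let $n \ge 0$ be an integer and let $X = \{[1:z_1:\cdots:z_n] \in \mathbb{C}P^n \mid z_i \neq 0 \ (1 \le i \le n)\} \cong (\mathbb{C}^*)^n$, an open complex submanifold of $\mathbb{C}P^n$, equipped with the restriction of the Fubini–Study metric, normalised so that its Kähler form is $\frac{\sqrt{-1}}{2\pi}\partial\bar\partial \log |v|^2$. For a holomorphic map $f:\mathbb{C}\to X$ put $$|df|(z) := \sqrt{2}\,\bigl|df(\partial/\partial z)\bigr|, \qquad \frac{\partial}{\partial z} = \frac12\Bigl(\frac{\partial}{\partial x} - \sqrt{-1}\,\frac{\partial}{\partial y}\Bigr),$$ where the norm on the complexified tangent spaces of $X$ is that of the Hermitian extension of the metric. (Equivalently, if $f = [1:f_1:\cdots:f_n]$, then $|df|^2 = \frac{1}{4\pi}\Delta\log\bigl(1+\sum_{i=1}^n |f_i|^2\bigr)$ with $\Delta = \partial_x^2+\partial_y^2$.) Let $\lambda \ge 0$ be a real number and let $[\lambda]$ be the largest integer not greater than $\lambda$. Let $f:\mathbb{C}\to X$ be a holomorphic map, and suppose that there is a positive constant $C$ such that $$|df|(z) \le C|z|^{\lambda} \qquad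 (|z|\ge 1).$$ Then there is a positive constant $C'$ such that $$|df|(z) \le C'|z|^{[\lambda]} \qquad (|z|\ge 1).$$ -/

import Mathlib

open Topology
open scoped LinearAlgebra.Projectivization Manifold

noncomputable section

/-- The complex projective space `ℂPⁿ`: the lines through the origin of `ℂⁿ⁺¹`. -/
abbrev CP (n : ℕ) : Type := ℙ ℂ (EuclideanSpace ℂ (Fin (n + 1)))

/-- `ℂPⁿ` carries the quotient topology of `ℂⁿ⁺¹ \ {0}`. -/
instance CP.instTopologicalSpace (n : ℕ) : TopologicalSpace (CP n) :=
  TopologicalSpace.coinduced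
    (fun v : {v : EuclideanSpace ℂ (Fin (n + 1)) // v ≠ 0} => Projectivization.mk ℂ v.1 v.2)
    inferInstance

/-- The vector `(1, z₁, …, zₙ)` of `ℂⁿ⁺¹`. -/
def homVec {n : ℕ} (z : EuclideanSpace ℂ (Fin n)) : EuclideanSpace ℂ (Fin (n + 1)) :=
  WithLp.toLp 2 (Fin.cons 1 z.ofLp)

theorem homVec_ne_zero {n : ℕ} (z : EuclideanSpace ℂ (Fin n)) : homVec z ≠ 0 := by
  intro h
  have h0 := congrArg (fun v : EuclideanSpace ℂ (Fin (n + 1)) => v 0) h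
  simp [homVec] at h0

/-- The point `[1 : z₁ : ⋯ : zₙ]` of `ℂPⁿ`. -/
def homPoint {n : ℕ} (z : EuclideanSpace ℂ (Fin n)) : CP n :=
  Projectivization.mk ℂ (homVec z) (homVec_ne_zero z)

/-- `X = {[1 : z₁ : ⋯ : zₙ] | zᵢ ≠ 0 for all i}`, the projectively embedded algebraic torus. -/
def torusSet (n : ℕ) : Set (CP n) :=
  {p | ∃ z : EuclideanSpace ℂ (Fin n), (∀ i, z i ≠ 0) ∧ p = homPoint z}

/-- `X` as a space, with the subspace topology from `ℂPⁿ`. -/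
abbrev Torus (n : ℕ) : Type := torusSet n

/-- The affine coordinates `[v₀ : v₁ : ⋯ : vₙ] ↦ (v₁ / v₀, …, vₙ / v₀)`
(meaningful where `v₀ ≠ 0`, in particular on `X`). -/
def affineCoord {n : ℕ} (p : CP n) : EuclideanSpace ℂ (Fin n) :=
  Projectivization.lift
    (fun v : {v : EuclideanSpace ℂ (Fin (n + 1)) // v ≠ 0} =>
      (WithLp.toLp 2 fun i : Fin n => v.1 i.succ / v.1 0 : EuclideanSpace ℂ (Fin n)))
    (by
      rintro ⟨a, ha⟩ ⟨b, hb⟩ t h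
      simp only at h
      have ht : t ≠ 0 := by
        rintro rfl
        exact ha (by simpa using h)
      subst h
      ext i
      simp [mul_div_mul_left _ _ ht])
    p

theorem affineCoord_homPoint {n : ℕ} (z : EuclideanSpace ℂ (Fin n)) :
    affineCoord (homPoint z) = z := by
  ext i
  simp [affineCoord, homPoint, homVec]

/-- The coordinates `(z₁, …, zₙ)` of a point of `X`. -/
def torusCoord (n : ℕ) (p : Torus n) : EuclideanSpace ℂ (Fin n) := affineCoord p.1

theorem homPoint_torusCoord {n : ℕ} (p : Torus n) : homPoint (torusCoord n p) = p.1 := by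
  obtain ⟨p, z, hz, rfl⟩ := p
  simp [torusCoord, affineCoord_homPoint]

theorem torusCoord_ne_zero {n : ℕ} (p : Torus n) (i : Fin n) : torusCoord n p i ≠ 0 := by
  obtain ⟨p, z, hz, rfl⟩ := p
  simpa [torusCoord, affineCoord_homPoint] using hz i

theorem continuous_homVec (n : ℕ) :
    Continuous (homVec : EuclideanSpace ℂ (Fin n) → EuclideanSpace ℂ (Fin (n + 1))) := by
  refine (PiLp.continuous_toLp 2 _).comp (continuous_pi fun i => ?_)
  refine Fin.cases ?_ (fun j => ?_) i
  · simpa using continuous_const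
  · simp only [Fin.cons_succ]
    fun_prop

theorem continuous_homPoint (n : ℕ) :
    Continuous (homPoint : EuclideanSpace ℂ (Fin n) → CP n) :=
  (continuous_coinduced_rng :
    Continuous (fun v : {v : EuclideanSpace ℂ (Fin (n + 1)) // v ≠ 0} =>
      Projectivization.mk ℂ v.1 v.2)).comp
    ((continuous_homVec n).subtype_mk homVec_ne_zero)

theorem mk_mem_torusSet_iff {n : ℕ} (v : EuclideanSpace ℂ (Fin (n + 1))) (hv : v ≠ 0) :
    Projectivization.mk ℂ v hv ∈ torusSet n ↔ ∀ i, v i ≠ 0 := by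
  constructor
  · rintro ⟨z, hz, h⟩
    obtain ⟨a, rfl⟩ := (Projectivization.mk_eq_mk_iff _ _ _ _ _).1 h
    intro i
    refine Fin.cases ?_ (fun j => ?_) i
    · simp [homVec, Units.smul_def]
    · simpa [homVec, Units.smul_def] using hz j
  · intro h
    refine ⟨WithLp.toLp 2 fun i => v i.succ / v 0, fun i => ?_, ?_⟩
    · exact div_ne_zero (h _) (h 0)
    · refine (Projectivization.mk_eq_mk_iff' _ _ _ _ _).2 ⟨v 0, ?_⟩
      ext i
      refine Fin.cases ?_ (fun j => ?_) i
      · simp [homVec]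
      · simp [homVec, mul_div_cancel₀ _ (h 0)]

theorem isOpenEmbedding_torusCoord (n : ℕ) : IsOpenEmbedding (torusCoord n) := by
  have hq : IsQuotientMap (fun v : {v : EuclideanSpace ℂ (Fin (n + 1)) // v ≠ 0} =>
      (Projectivization.mk ℂ v.1 v.2 : CP n)) :=
    ⟨⟨rfl⟩, fun p => ⟨⟨p.rep, p.rep_nonzero⟩, p.mk_rep⟩⟩
  have hopen : IsOpen (torusSet n) := by
    rw [← hq.isOpen_preimage]
    have : (fun v : {v : EuclideanSpace ℂ (Fin (n + 1)) // v ≠ 0} =>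
        (Projectivization.mk ℂ v.1 v.2 : CP n)) ⁻¹' torusSet n = {v | ∀ i, v.1 i ≠ 0} := by
      ext v
      exact mk_mem_torusSet_iff v.1 v.2
    rw [this, Set.ofPred_forall]
    refine isOpen_iInter_of_finite fun i => isOpen_ne_fun ?_ continuous_const
    fun_prop
  have hcont : Continuous (torusCoord n) := by
    rw [(hq.restrictPreimage_isOpen hopen).continuous_iff]
    refine (PiLp.continuous_toLp 2 _).comp (continuous_pi fun i => ?_)
    refine Continuous.div (by fun_prop) (by fun_prop) ?_
    rintro ⟨v, hv⟩
    exact (mk_mem_torusSet_iff v.1 v.2).1 hv 0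
  have hrange : Set.range (torusCoord n) = {z | ∀ i, z i ≠ 0} := by
    ext z
    constructor
    · rintro ⟨p, rfl⟩
      exact torusCoord_ne_zero p
    · intro hz
      exact ⟨⟨homPoint z, z, hz, rfl⟩, affineCoord_homPoint z⟩
  have hcomp : homPoint ∘ torusCoord n = Subtype.val := funext homPoint_torusCoord
  refine ⟨⟨IsInducing.of_comp hcont (continuous_homPoint n) ?_, ?_⟩, ?_⟩
  · rw [hcomp]
    exact IsInducing.subtypeVal
  · intro p q h
    apply Subtype.ext
    rw [← homPoint_torusCoord p, h, homPoint_torusCoord q]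
  · rw [hrange, Set.ofPred_forall]
    refine isOpen_iInter_of_finite fun i => isOpen_ne_fun ?_ continuous_const
    fun_prop

instance Torus.instNonempty (n : ℕ) : Nonempty (Torus n) :=
  ⟨⟨homPoint (WithLp.toLp 2 fun _ => 1), _, fun _ => one_ne_zero, rfl⟩⟩

/-- The complex manifold structure of `X`: the affine coordinates `(z₁, …, zₙ)` are a global
holomorphic chart, identifying `X` with the open set `(ℂ*)ⁿ` of `ℂⁿ`. -/
instance Torus.instChartedSpace (n : ℕ) : ChartedSpace (EuclideanSpace ℂ (Fin n)) (Torus n) :=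
  (isOpenEmbedding_torusCoord n).singletonChartedSpace

instance Torus.instIsManifold (n : ℕ) (k : WithTop ℕ∞) :
    IsManifold 𝓘(ℂ, EuclideanSpace ℂ (Fin n)) k (Torus n) :=
  (isOpenEmbedding_torusCoord n).isManifold_singleton

/-- The Fubini-Study Hermitian form of `ℂPⁿ`, normalised so that a projective line has area `1`
(i.e. with Kähler form `(i / 2π) ∂∂̄ log |v|²`). A tangent vector of `ℂPⁿ` at `[v]` is the image of
some `a ∈ ℂⁿ⁺¹` under the differential at `v` of the projection `ℂⁿ⁺¹ \ {0} → ℂPⁿ`; this is the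
product of the images of `a` and `b`. -/
def fubiniStudyForm {n : ℕ} (v a b : EuclideanSpace ℂ (Fin (n + 1))) : ℂ :=
  (inner ℂ a b * inner ℂ v v - inner ℂ a v * inner ℂ v b) / (Real.pi * inner ℂ v v ^ 2)

/-- The Riemannian metric of `X`: the restriction of the Fubini-Study metric. In the chart
`(z₁, …, zₙ)`, a tangent vector `ξ ∈ ℂⁿ` of `X` at `p = [1 : z]` is the image of
`(0, ξ) = (1, z + ξ) - (1, z) ∈ ℂⁿ⁺¹` under the differential of the projection at `(1, z)`. -/
def torusMetric {n : ℕ} (p : Torus n)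
    (ξ η : TangentSpace 𝓘(ℂ, EuclideanSpace ℂ (Fin n)) p) : ℝ :=
  let zero_cons (w : EuclideanSpace ℂ (Fin n)) : EuclideanSpace ℂ (Fin (n + 1)) :=
    WithLp.toLp 2 (Fin.cons 0 w.ofLp)
  (fubiniStudyForm (homVec (torusCoord n p)) (zero_cons ξ) (zero_cons η)).re

/-- The norm `|ξ + √-1 η|` of a vector of the complexified tangent space `T_p X ⊗ ℂ`, for the
Hermitian extension of the Riemannian metric: its square is `|ξ|² + |η|²`. -/
def complexTangentNorm {n : ℕ} (p : Torus n)
    (ξ η : TangentSpace 𝓘(ℂ, EuclideanSpace ℂ (Fin n)) p) : ℝ :=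
  √(torusMetric p ξ ξ + torusMetric p η η)

/-- `|df|(z) = √2 |df(∂/∂z)|`, where `∂/∂z = (1/2) ∂/∂x - √-1 (1/2) ∂/∂y`; the vectors `∂/∂x`,
`∂/∂y` of `ℂ` are `1` and `I`. -/
def dnorm {n : ℕ} (f : ℂ → Torus n) (z : ℂ) : ℝ :=
  let df := mfderiv 𝓘(ℂ, ℂ) 𝓘(ℂ, EuclideanSpace ℂ (Fin n)) f z
  let half : ℂ := 1 / 2
  √2 * complexTangentNorm (f z) (df half) (df (-(half * Complex.I)))

end

/-! Since ℂ is simply connected, the coordinates of `f` are `exp gᵢ` with `gᵢ` entire; put `g₀ = 0`.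
In these terms π|df|² is the variance of the numbers `gᵢ'` for the probability weights proportional
to `|exp gᵢ|²`, and it is a quarter of the Laplacian of L = log ∑ exp(2 Re gᵢ).

Polynomial growth of |df| therefore bounds ΔL, and integrating twice in log |z| bounds the circular
means of L (`integral_logSumExp_le`). As L dominates both 0 and 2 Re gᵢ, and the means of Re gᵢ are
constant, the means of |Re gᵢ| grow polynomially too, which forces every `gᵢ` to be a polynomial
(`exists_polynomial_of_derivVar_le`).

The gain from λ to [λ] is integrality of degrees. Let d be the largest degree. By connectedness,
each large circle has a point where two `gᵢ`, `gⱼ` with different coefficients in degree d both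
attain the maximal real part (`eventually_exists_common_maximizers`). Their weights there are at
least 1/(n+1), so the variance is at least a constant times |gᵢ' - gⱼ'|², of order |z|^(2(d-1)).
Hence d - 1 ≤ λ, so d - 1 ≤ [λ] (`natDegree_le_of_derivVar_le`), and the variance is at most ∑
|gᵢ'|² = O(|z|^(2[λ])). -/

/-- The weights `exp (2 Re gᵢ) / ∑ⱼ exp (2 Re gⱼ)`. -/
noncomputable def expWeight {ι : Type*} [Fintype ι] (g : ι → ℂ → ℂ) (i : ι) (z : ℂ) : ℝ :=
  Real.exp (2 * (g i z).re) / ∑ j, Real.exp (2 * (g j z).re)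

/-- The expectation of the derivatives `gᵢ'` for the weights `expWeight g`. -/
noncomputable def derivMean {ι : Type*} [Fintype ι] (g : ι → ℂ → ℂ) (z : ℂ) : ℂ :=
  ∑ i, (expWeight g i z : ℂ) * deriv (g i) z

/-- The variance of the derivatives `gᵢ'` for the weights `expWeight g`. -/
noncomputable def derivVar {ι : Type*} [Fintype ι] (g : ι → ℂ → ℂ) (z : ℂ) : ℝ :=
  ∑ i, expWeight g i z * ‖deriv (g i) z‖ ^ 2 - ‖derivMean g z‖ ^ 2

/-! ### Logarithmic coordinates and the Fubini–Study norm as a variance -/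

theorem torusCoord_comp_mdifferentiable {n : ℕ} {f : ℂ → Torus n}
    (hf : MDifferentiable 𝓘(ℂ, ℂ) 𝓘(ℂ, EuclideanSpace ℂ (Fin n)) f) :
    Differentiable ℂ fun z => torusCoord n (f z) := by
  intro z
  have h := (mdifferentiableAt_iff_of_mem_source (x' := z) (y := f z)
    (mem_chart_source _ z) (mem_chart_source _ (f z))).1 (hf z)
  have h2 := h.2
  simp only [mfld_simps] at h2
  exact h2.differentiableAt Filter.univ_mem

theorem mfderiv_torus {n : ℕ} {f : ℂ → Torus n}
    (hf : MDifferentiable 𝓘(ℂ, ℂ) 𝓘(ℂ, EuclideanSpace ℂ (Fin n)) f) (z : ℂ) :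
    mfderiv 𝓘(ℂ, ℂ) 𝓘(ℂ, EuclideanSpace ℂ (Fin n)) f z =
      fderiv ℂ (fun z => torusCoord n (f z)) z := by
  rw [(hf z).mfderiv]
  simp only [mfld_simps, fderivWithin_univ]
  rfl

/-- Take for `g` the primitive of F'/F with g(0) = log F(0); then F·exp(-g) has zero derivative and
equals 1 at 0. -/
theorem exists_exp_eq {F : ℂ → ℂ} (hF : Differentiable ℂ F) (h0 : ∀ z, F z ≠ 0) :
    ∃ g : ℂ → ℂ, Differentiable ℂ g ∧ ∀ z, F z = Complex.exp (g z) := by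
  have hd : Differentiable ℂ fun z => deriv F z / F z :=
    (hF.contDiff (n := 2).differentiable_deriv_two).div hF h0
  obtain ⟨g, hg0, hg⟩ := hd.isExactOn_univ.with_val_at 0 (Complex.log (F 0))
  have hgd : Differentiable ℂ g := fun z => (hg z trivial).differentiableAt
  refine ⟨g, hgd, ?_⟩
  have hq : ∀ z, HasDerivAt (fun z => F z * Complex.exp (-g z)) 0 z := by
    intro z
    convert! (hF z).hasDerivAt.mul (hg z trivial).neg.cexp using 1
    field_simp [h0 z]
    ring
  intro z
  have := is_const_of_deriv_eq_zero (fun z => (hq z).differentiableAt) (fun z => (hq z).deriv) z 0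
  simp only [hg0, Complex.exp_neg, Complex.exp_log (h0 0), mul_inv_cancel₀ (h0 0)] at this
  rwa [mul_inv_eq_one₀ (Complex.exp_ne_zero _)] at this

/-- With `D` the logarithmic derivatives of the homogeneous coordinates, the Gram expression
defining the metric becomes second moment minus squared mean, for the weights |vᵢ|²/|v|². The scalar
`w` allows evaluation at both 1/2 and -i/2. -/
theorem fubiniStudyForm_re {n : ℕ} (v a : EuclideanSpace ℂ (Fin (n + 1)))
    (D : Fin (n + 1) → ℂ) (w : ℂ) (ha : ∀ i, a i = w * (D i * v i)) :
    (fubiniStudyForm v a a).re = ‖w‖ ^ 2 * ((∑ i, ‖v i‖ ^ 2 / (∑ j, ‖v j‖ ^ 2) * ‖D i‖ ^ 2 -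
      ‖∑ i, ((‖v i‖ ^ 2 / (∑ j, ‖v j‖ ^ 2) : ℝ) : ℂ) * D i‖ ^ 2) / Real.pi) := by
  set S := ∑ j, ‖v j‖ ^ 2 with hS
  have hn : ∀ x : ℂ, (starRingEnd ℂ) x * x = ((‖x‖ ^ 2 : ℝ) : ℂ) := fun x => by
    rw [mul_comm, Complex.mul_conj, Complex.normSq_eq_norm_sq]
  have hvv : inner ℂ v v = (S : ℂ) := by
    simp only [PiLp.inner_apply, RCLike.inner_apply', hn, hS, Complex.ofReal_sum]
  have haa : inner ℂ a a = ((‖w‖ ^ 2 * ∑ i, ‖v i‖ ^ 2 * ‖D i‖ ^ 2 : ℝ) : ℂ) := by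
    simp only [PiLp.inner_apply, RCLike.inner_apply', hn, Finset.mul_sum, Complex.ofReal_sum]
    refine Finset.sum_congr rfl fun i _ => ?_
    rw [ha, norm_mul, norm_mul]
    push_cast
    ring
  have hva : inner ℂ v a = w * ∑ i, ((‖v i‖ ^ 2 : ℝ) : ℂ) * D i := by
    simp only [PiLp.inner_apply, RCLike.inner_apply', Finset.mul_sum]
    refine Finset.sum_congr rfl fun i _ => ?_
    rw [ha, ← hn]
    ring
  have hav : inner ℂ a v * inner ℂ v a =
      ((‖w‖ ^ 2 * ‖∑ i, ((‖v i‖ ^ 2 : ℝ) : ℂ) * D i‖ ^ 2 : ℝ) : ℂ) := by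
    rw [← inner_conj_symm a v, hn, hva, norm_mul, mul_pow]
  have hsum : ∑ i, ((‖v i‖ ^ 2 / S : ℝ) : ℂ) * D i =
      (S : ℂ)⁻¹ * ∑ i, ((‖v i‖ ^ 2 : ℝ) : ℂ) * D i := by
    rw [Finset.mul_sum]
    refine Finset.sum_congr rfl fun i _ => ?_
    push_cast
    ring
  have hsum' : ∑ i, ‖v i‖ ^ 2 / S * ‖D i‖ ^ 2 = S⁻¹ * ∑ i, ‖v i‖ ^ 2 * ‖D i‖ ^ 2 := by
    rw [Finset.mul_sum]
    refine Finset.sum_congr rfl fun i _ => ?_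
    ring
  rw [fubiniStudyForm, hav, haa, hvv, hsum, hsum', norm_mul, mul_pow, norm_inv, Complex.norm_real,
    Real.norm_eq_abs, inv_pow, sq_abs]
  norm_cast
  rcases eq_or_ne S 0 with h | h
  · simp [h]
  · field_simp

/-- In logarithmic coordinates `|df|²` is the variance of the derivatives, divided by `π`. -/
theorem dnorm_eq_sqrt_derivVar {n : ℕ} {f : ℂ → Torus n}
    (hf : MDifferentiable 𝓘(ℂ, ℂ) 𝓘(ℂ, EuclideanSpace ℂ (Fin n)) f)
    {g : Fin n → ℂ → ℂ} (hg : ∀ i, Differentiable ℂ (g i))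
    (hfg : ∀ z i, torusCoord n (f z) i = Complex.exp (g i z)) (z : ℂ) :
    dnorm f z = √(derivVar (Fin.cons 0 g : Fin (n + 1) → ℂ → ℂ) z / Real.pi) := by
  have hfd : ∀ w : ℂ, fderiv ℂ (fun z => torusCoord n (f z)) z w =
      WithLp.toLp 2 fun i => w * (deriv (g i) z * Complex.exp (g i z)) := by
    intro w
    have h1 : (fun z => torusCoord n (f z)) = fun z => WithLp.toLp 2 fun i => Complex.exp (g i z) := by
      funext z; ext i; simp [hfg]
    have h2 : HasDerivAt (fun z => (WithLp.toLp 2 fun i => Complex.exp (g i z) :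
        EuclideanSpace ℂ (Fin n))) (WithLp.toLp 2 fun i => deriv (g i) z * Complex.exp (g i z)) z := by
      refine (PiLp.continuousLinearEquiv 2 ℂ fun _ : Fin n => ℂ).symm.hasFDerivAt.comp_hasDerivAt z
        (hasDerivAt_pi.2 fun i => ?_)
      simpa [mul_comm] using (hg i z).hasDerivAt.cexp
    rw [h1, h2.hasFDerivAt.fderiv]
    ext i
    simp
  have hv : ∀ i, ‖homVec (torusCoord n (f z)) i‖ ^ 2 =
      Real.exp (2 * ((Fin.cons 0 g : Fin (n + 1) → ℂ → ℂ) i z).re) := by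
    refine Fin.cases ?_ fun i => ?_
    · simp [homVec]
    · simp [homVec, hfg, Complex.norm_exp, ← Real.exp_nat_mul]
  have hm : ∀ w : ℂ, torusMetric (f z) (fderiv ℂ (fun z => torusCoord n (f z)) z w)
      (fderiv ℂ (fun z => torusCoord n (f z)) z w) =
      ‖w‖ ^ 2 * (derivVar (Fin.cons 0 g : Fin (n + 1) → ℂ → ℂ) z / Real.pi) := by
    intro w
    refine (fubiniStudyForm_re _ _ (fun i => deriv ((Fin.cons 0 g : Fin (n + 1) → ℂ → ℂ) i) z) w
      ?_).trans ?_
    · rw [hfd]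
      refine Fin.cases ?_ fun i => ?_
      · simp
      · simp [homVec, hfg]
    · simp only [hv, derivVar, derivMean, expWeight]
  rw [dnorm, mfderiv_torus hf, complexTangentNorm]
  erw [hm, hm]
  -- |1/2|² + |-i/2|² = 1/2 cancels the factor 2 coming from √2.
  rw [← Real.sqrt_mul (by norm_num)]
  congr 1
  simp
  ring

/-! ### Green's formula on a period strip -/

-- Green's formula on the rectangle [0, s] × [0, 2π]: the horizontal sides cancel by periodicity.
-- The integrand on the right is 2i ∂̄f.
open Complex in
theorem integral_sub_of_periodic {f : ℂ → ℂ} {f' : ℂ → ℂ →L[ℝ] ℂ}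
    (hf : ∀ w, HasFDerivAt f (f' w) w) (hc : Continuous fun w => I * f' w 1 - f' w I)
    (hper : ∀ w, f (w + 2 * Real.pi * I) = f w) (s : ℝ) :
    I * ((∫ y in (0 : ℝ)..2 * Real.pi, f (s + y * I)) - ∫ y in (0 : ℝ)..2 * Real.pi, f (y * I)) =
      ∫ x in (0 : ℝ)..s, ∫ y in (0 : ℝ)..2 * Real.pi,
        (I * f' (x + y * I) 1 - f' (x + y * I) I) := by
  have hcont : Continuous f := continuous_iff_continuousAt.2 fun w => (hf w).continuousAt
  have h := integral_boundary_rect_of_hasFDerivAt_real_off_countable f f' 0 (s + 2 * Real.pi * I) ∅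
    Set.countable_empty hcont.continuousOn (fun x _ => hf x)
    (hc.continuousOn.integrableOn_compact (isCompact_uIcc.reProdIm isCompact_uIcc))
  simp [hper] at h
  rw [← h]
  ring

/-! ### Calculus of log-sum-exp and growth of its circular means -/

section

variable {ι : Type*} [Fintype ι]

/-- The logarithm of `∑ᵢ exp (2 Re hᵢ)`. -/
noncomputable def logSumExp (h : ι → ℂ → ℂ) (w : ℂ) : ℝ :=
  Real.log (∑ i, Real.exp (2 * (h i w).re))

theorem sum_exp_pos [Nonempty ι] (h : ι → ℂ → ℂ) (w : ℂ) : 0 < ∑ i, Real.exp (2 * (h i w).re) :=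
  Finset.sum_pos (fun _ _ => Real.exp_pos _) Finset.univ_nonempty

theorem expWeight_pos [Nonempty ι] (h : ι → ℂ → ℂ) (i : ι) (w : ℂ) : 0 < expWeight h i w :=
  div_pos (Real.exp_pos _) (sum_exp_pos h w)

theorem sum_expWeight [Nonempty ι] (h : ι → ℂ → ℂ) (w : ℂ) : ∑ i, expWeight h i w = 1 := by
  simp only [expWeight, ← Finset.sum_div]
  exact div_self (sum_exp_pos h w).ne'

theorem expWeight_eq_exp [Nonempty ι] (h : ι → ℂ → ℂ) (i : ι) (w : ℂ) :
    expWeight h i w = Real.exp (2 * (h i w).re - logSumExp h w) := by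
  rw [Real.exp_sub, logSumExp, Real.exp_log (sum_exp_pos h w), expWeight]

/-- The real linear form `v ↦ 2 Re (c v)`. -/
noncomputable def twoReMul (c : ℂ) : ℂ →L[ℝ] ℝ :=
  (2 : ℝ) • Complex.reCLM.comp (c • (1 : ℂ →L[ℝ] ℂ))

@[simp] theorem twoReMul_apply (c v : ℂ) : twoReMul c v = 2 * (c * v).re := by
  simp [twoReMul]

theorem HasDerivAt.two_mul_re {h : ℂ → ℂ} {c w : ℂ} (hh : HasDerivAt h c w) :
    HasFDerivAt (fun w => 2 * (h w).re) (twoReMul c) w :=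
  (Complex.reCLM.hasFDerivAt.comp w hh.complexToReal_fderiv).const_mul 2

/-- That is, ∂L = `derivMean h` for L = `logSumExp h`, L being real. -/
theorem hasFDerivAt_logSumExp [Nonempty ι] {h : ι → ℂ → ℂ} (hh : ∀ i, Differentiable ℂ (h i))
    (w : ℂ) : HasFDerivAt (logSumExp h) (twoReMul (derivMean h w)) w := by
  have h1 : HasFDerivAt (fun w => ∑ i, Real.exp (2 * (h i w).re))
      (∑ i, Real.exp (2 * (h i w).re) • twoReMul (deriv (h i) w)) w :=
    HasFDerivAt.fun_sum fun i _ => ((hh i w).hasDerivAt.two_mul_re).exp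
  convert! h1.log (sum_exp_pos h w).ne' using 1
  ext v
  simp only [twoReMul_apply, derivMean, expWeight, smul_apply,
    sum_apply, smul_eq_mul, Finset.sum_mul, Finset.mul_sum, Complex.re_sum]
  refine Finset.sum_congr rfl fun i _ => ?_
  rw [mul_assoc, Complex.re_ofReal_mul]
  ring

theorem hasFDerivAt_expWeight [Nonempty ι] {h : ι → ℂ → ℂ} (hh : ∀ i, Differentiable ℂ (h i))
    (i : ι) (w : ℂ) : HasFDerivAt (expWeight h i)
      (expWeight h i w • (twoReMul (deriv (h i) w) - twoReMul (derivMean h w))) w := by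
  have h1 := (((hh i w).hasDerivAt.two_mul_re).sub (hasFDerivAt_logSumExp hh w)).exp
  simp only [expWeight_eq_exp, funext (expWeight_eq_exp h i)]
  exact h1

/-- The real derivative of `derivMean h` at `w`. -/
noncomputable def derivMeanFDeriv (h : ι → ℂ → ℂ) (w : ℂ) : ℂ →L[ℝ] ℂ :=
  ∑ i, ((expWeight h i w : ℂ) • (deriv (deriv (h i)) w • (1 : ℂ →L[ℝ] ℂ)) +
    (Complex.ofRealCLM.comp
      (expWeight h i w • (twoReMul (deriv (h i) w) - twoReMul (derivMean h w)))).smulRight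
      (deriv (h i) w))

theorem hasFDerivAt_derivMean [Nonempty ι] {h : ι → ℂ → ℂ} (hh : ∀ i, Differentiable ℂ (h i))
    (w : ℂ) : HasFDerivAt (derivMean h) (derivMeanFDeriv h w) w := by
  refine HasFDerivAt.fun_sum fun i _ => ?_
  have h1 := Complex.ofRealCLM.hasFDerivAt.comp w (hasFDerivAt_expWeight hh i w)
  have h2 := ((hh i).contDiff (n := 2).differentiable_deriv_two w).hasDerivAt.complexToReal_fderiv
  exact h1.smul h2

/-- This says ∂̄ `derivMean` = `derivVar`. The `hᵢ'` are holomorphic, so only the weights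
contribute, and ∂̄pᵢ = pᵢ · conj(hᵢ' - P) with P the mean. With ∂L = P it gives ΔL = 4 `derivVar`.
-/
theorem derivMeanFDeriv_dbar [Nonempty ι] (h : ι → ℂ → ℂ) (w : ℂ) :
    Complex.I * derivMeanFDeriv h w 1 - derivMeanFDeriv h w Complex.I =
      2 * Complex.I * derivVar h w := by
  set P := derivMean h w with hP
  have key : ∀ i, Complex.I * ((expWeight h i w : ℂ) * (deriv (deriv (h i)) w) +
      ((expWeight h i w * (2 * (deriv (h i) w).re - 2 * P.re) : ℝ) : ℂ) * deriv (h i) w) -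
      ((expWeight h i w : ℂ) * (deriv (deriv (h i)) w * Complex.I) +
      ((expWeight h i w * (2 * (deriv (h i) w * Complex.I).re - 2 * (P * Complex.I).re) : ℝ) : ℂ) *
        deriv (h i) w) =
      2 * Complex.I * ((expWeight h i w * ‖deriv (h i) w‖ ^ 2 : ℝ) -
        (expWeight h i w * deriv (h i) w) * (starRingEnd ℂ) P) := by
    intro i
    rw [Complex.ofReal_mul (expWeight h i w) (‖_‖ ^ 2), ← Complex.normSq_eq_norm_sq,
      ← Complex.mul_conj]
    have hc : ∀ x : ℂ, (starRingEnd ℂ) x = x.re - x.im * Complex.I := fun x => by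
      apply Complex.ext <;> simp
    rw [hc, hc]
    simp only [Complex.mul_re, Complex.I_re, Complex.I_im]
    push_cast
    linear_combination (2 * (expWeight h i w : ℂ) * deriv (h i) w * ((deriv (h i) w).im - P.im)) *
      Complex.I_sq
  have h1 : ∀ v, derivMeanFDeriv h w v = ∑ i, ((expWeight h i w : ℂ) * (deriv (deriv (h i)) w * v) +
      ((expWeight h i w * (2 * (deriv (h i) w * v).re - 2 * (P * v).re) : ℝ) : ℂ) *
        deriv (h i) w) := by
    intro v
    simp [derivMeanFDeriv, hP]
  rw [h1, h1, Finset.mul_sum, ← Finset.sum_sub_distrib]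
  simp only [mul_one]
  rw [Finset.sum_congr rfl fun i _ => key i, ← Finset.mul_sum, Finset.sum_sub_distrib,
    ← Finset.sum_mul, derivVar]
  congr 1
  have : ∑ i, (expWeight h i w : ℂ) * deriv (h i) w = P := rfl
  rw [this, Complex.mul_conj, Complex.normSq_eq_norm_sq, ← hP]
  push_cast
  rfl

theorem continuous_expWeight [Nonempty ι] {h : ι → ℂ → ℂ} (hh : ∀ i, Differentiable ℂ (h i))
    (i : ι) : Continuous (expWeight h i) :=
  continuous_iff_continuousAt.2 fun w => (hasFDerivAt_expWeight hh i w).continuousAt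

theorem continuous_logSumExp [Nonempty ι] {h : ι → ℂ → ℂ} (hh : ∀ i, Differentiable ℂ (h i)) :
    Continuous (logSumExp h) :=
  continuous_iff_continuousAt.2 fun w => (hasFDerivAt_logSumExp hh w).continuousAt

theorem continuous_derivMean [Nonempty ι] {h : ι → ℂ → ℂ} (hh : ∀ i, Differentiable ℂ (h i)) :
    Continuous (derivMean h) :=
  continuous_iff_continuousAt.2 fun w => (hasFDerivAt_derivMean hh w).continuousAt

theorem continuous_derivVar [Nonempty ι] {h : ι → ℂ → ℂ} (hh : ∀ i, Differentiable ℂ (h i)) :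
    Continuous (derivVar h) := by
  have h1 := continuous_expWeight hh
  have h2 := continuous_derivMean hh
  have h3 : ∀ i, Continuous (deriv (h i)) := fun i =>
    ((hh i).contDiff (n := 2).differentiable_deriv_two).continuous
  unfold derivVar
  fun_prop

/-- Jensen's inequality for `log ∑ᵢ exp (2 Re hᵢ)` on a vertical period strip. -/
theorem integral_logSumExp_le [Nonempty ι] {h : ι → ℂ → ℂ} (hh : ∀ i, Differentiable ℂ (h i))
    (hper : ∀ i w, h i (w + 2 * Real.pi * Complex.I) = h i w)
    {C : ℝ} {N : ℕ} (hV : ∀ w : ℂ, 0 ≤ w.re → derivVar h w ≤ C * Real.exp (N * w.re)) :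
    ∃ K, 0 ≤ K ∧ ∀ s : ℝ, 0 ≤ s →
      ∫ y in (0 : ℝ)..2 * Real.pi, logSumExp h (s + y * Complex.I) ≤
        K * Real.exp ((N + 2 : ℕ) * s) := by
  have hdper : ∀ i w, deriv (h i) (w + 2 * Real.pi * Complex.I) = deriv (h i) w := fun i w => by
    rw [← deriv_comp_add_const]
    simp only [hper]
  have hwper : ∀ i w, expWeight h i (w + 2 * Real.pi * Complex.I) = expWeight h i w := fun i w => by
    simp only [expWeight, hper]
  have hPper : ∀ w, derivMean h (w + 2 * Real.pi * Complex.I) = derivMean h w := fun w => by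
    simp only [derivMean, hwper, hdper]
  have hLper : ∀ w, logSumExp h (w + 2 * Real.pi * Complex.I) = logSumExp h w := fun w => by
    simp only [logSumExp, hper]
  have hPc := continuous_derivMean hh
  have hVc := continuous_derivVar hh
  have hLc := continuous_logSumExp hh
  have hlinec : ∀ s : ℝ, Continuous fun y : ℝ => (s + y * Complex.I : ℂ) := fun s => by fun_prop
  have hpi := Real.pi_pos
  -- the growth of the circular means of `derivMean`
  set M := fun s : ℝ => ∫ y in (0 : ℝ)..2 * Real.pi, (derivMean h (s + y * Complex.I)).re with hM
  have hMc : Continuous M :=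
    intervalIntegral.continuous_parametric_intervalIntegral_of_continuous' (by fun_prop) _ _
  -- Green's formula for `derivMean`, whose ∂̄ is the variance.
  have hMeq : ∀ s, M s = M 0 + 2 * ∫ x in (0 : ℝ)..s, ∫ y in (0 : ℝ)..2 * Real.pi,
      derivVar h (x + y * Complex.I) := by
    intro s
    have h1 := integral_sub_of_periodic (hasFDerivAt_derivMean hh)
      (by simp only [derivMeanFDeriv_dbar]; fun_prop) hPper s
    simp only [derivMeanFDeriv_dbar, intervalIntegral.integral_const_mul,
      intervalIntegral.integral_ofReal] at h1
    have h2 : ∀ s : ℝ, M s = (∫ y in (0 : ℝ)..2 * Real.pi, derivMean h (s + y * Complex.I)).re := by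
      intro s
      exact Complex.reCLM.intervalIntegral_comp_comm
        ((hPc.comp (hlinec s)).intervalIntegrable _ _)
    have h3 := congrArg Complex.im h1
    rw [h2, h2]
    simp at h3
    simp
    linarith
  -- Each integration in s costs at most a factor s ≤ exp s, hence one unit in the exponent; the two
  -- integrations turn N into N + 2.
  have hMle : ∀ s, 0 ≤ s → M s ≤ (|M 0| + 4 * Real.pi * |C|) * Real.exp ((N + 1 : ℕ) * s) := by
    intro s hs
    have hin : ∀ x ∈ Set.Icc 0 s, ∫ y in (0 : ℝ)..2 * Real.pi, derivVar h (x + y * Complex.I) ≤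
        2 * Real.pi * (|C| * Real.exp (N * s)) := by
      intro x hx
      have h1 := intervalIntegral.integral_mono_on (μ := MeasureTheory.volume) (a := 0) (b := 2 * Real.pi)
        (f := fun y : ℝ => derivVar h (x + y * Complex.I)) (g := fun _ => |C| * Real.exp (N * s))
        (by positivity) ((hVc.comp (hlinec x)).intervalIntegrable _ _) intervalIntegrable_const (fun y _ => by
          refine (hV _ (by simpa using hx.1)).trans ?_
          gcongr
          · exact le_abs_self C
          · simpa using hx.2)
      simpa only [intervalIntegral.integral_const, smul_eq_mul, sub_zero] using h1
    have h2 := intervalIntegral.integral_mono_on (μ := MeasureTheory.volume) (a := 0) (b := s)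
        (f := fun x : ℝ => ∫ y in (0 : ℝ)..2 * Real.pi, derivVar h (x + y * Complex.I))
        (g := fun _ => 2 * Real.pi * (|C| * Real.exp (N * s))) hs
        ((intervalIntegral.continuous_parametric_intervalIntegral_of_continuous' (by fun_prop)
          _ _).intervalIntegrable _ _) intervalIntegrable_const hin
    rw [hMeq]
    simp only [intervalIntegral.integral_const, smul_eq_mul, sub_zero] at h2
    have h3 : Real.exp ((N + 1 : ℕ) * s) = Real.exp (N * s) * Real.exp s := by
      rw [← Real.exp_add]; push_cast; ring_nf
    have h4 : 1 ≤ Real.exp ((N + 1 : ℕ) * s) := Real.one_le_exp (by positivity)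
    have h5 : s ≤ Real.exp s := by linarith [Real.add_one_le_exp s]
    have h6 : s * (2 * Real.pi * (|C| * Real.exp (N * s))) ≤
        2 * Real.pi * |C| * Real.exp ((N + 1 : ℕ) * s) := by
      rw [h3]
      calc _ ≤ Real.exp s * (2 * Real.pi * (|C| * Real.exp (N * s))) := by gcongr
        _ = _ := by ring
    nlinarith [le_abs_self (M 0), abs_nonneg (M 0)]
  -- the growth of the circular means of `logSumExp`
  set Φ := fun s : ℝ => ∫ y in (0 : ℝ)..2 * Real.pi, logSumExp h (s + y * Complex.I) with hΦ
  -- Green's formula again, for the real function L: ∂̄L is the conjugate of `derivMean`.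
  have hΦeq : ∀ s, Φ s = Φ 0 + 2 * ∫ x in (0 : ℝ)..s, M x := by
    intro s
    have hcast : ∀ w, HasFDerivAt (fun w => (logSumExp h w : ℂ))
        (Complex.ofRealCLM.comp (twoReMul (derivMean h w))) w := fun w =>
      Complex.ofRealCLM.hasFDerivAt.comp w (hasFDerivAt_logSumExp hh w)
    have hval : ∀ w, Complex.I * Complex.ofRealCLM.comp (twoReMul (derivMean h w)) 1 -
        Complex.ofRealCLM.comp (twoReMul (derivMean h w)) Complex.I =
        2 * Complex.I * (starRingEnd ℂ (derivMean h w)) := by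
      intro w
      apply Complex.ext <;> simp
    have h1 := integral_sub_of_periodic hcast (by simp only [hval]; fun_prop)
      (fun w => by rw [hLper]) s
    simp only [hval, intervalIntegral.integral_const_mul, intervalIntegral.integral_ofReal] at h1
    have h4 := congrArg Complex.im h1
    have h5 : (∫ x in (0 : ℝ)..s, ∫ y in (0 : ℝ)..2 * Real.pi,
        (starRingEnd ℂ (derivMean h (x + y * Complex.I)))).re = ∫ x in (0 : ℝ)..s, M x := by
      have h6 := Complex.reCLM.intervalIntegral_comp_comm (μ := MeasureTheory.volume)
        (a := 0) (b := s) (f := fun x : ℝ => ∫ y in (0 : ℝ)..2 * Real.pi,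
          (starRingEnd ℂ (derivMean h (x + y * Complex.I))))
        ((intervalIntegral.continuous_parametric_intervalIntegral_of_continuous' (by fun_prop)
          _ _).intervalIntegrable _ _)
      refine h6.symm.trans ?_
      congr 1
      funext x
      refine (Complex.reCLM.intervalIntegral_comp_comm
        (Continuous.intervalIntegrable (by fun_prop) _ _)).symm.trans ?_
      simp [hM]
    simp [h5] at h4
    simp [hΦ]
    linarith
  refine ⟨|Φ 0| + 2 * (|M 0| + 4 * Real.pi * |C|), by positivity, fun s hs => ?_⟩
  have h2 := intervalIntegral.integral_mono_on (μ := MeasureTheory.volume) (a := 0) (b := s) (f := M)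
    (g := fun _ => (|M 0| + 4 * Real.pi * |C|) * Real.exp ((N + 1 : ℕ) * s)) hs
    (hMc.intervalIntegrable _ _) intervalIntegrable_const (fun x hx => by
      refine (hMle x hx.1).trans ?_
      gcongr
      exact hx.2)
  simp only [intervalIntegral.integral_const, smul_eq_mul, sub_zero] at h2
  have h3 : Real.exp ((N + 2 : ℕ) * s) = Real.exp ((N + 1 : ℕ) * s) * Real.exp s := by
    rw [← Real.exp_add]; push_cast; ring_nf
  have h4 : 1 ≤ Real.exp ((N + 2 : ℕ) * s) := Real.one_le_exp (by positivity)
  have h5 : s ≤ Real.exp s := by linarith [Real.add_one_le_exp s]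
  have h6 : s * ((|M 0| + 4 * Real.pi * |C|) * Real.exp ((N + 1 : ℕ) * s)) ≤
      (|M 0| + 4 * Real.pi * |C|) * Real.exp ((N + 2 : ℕ) * s) := by
    rw [h3]
    calc _ ≤ Real.exp s * ((|M 0| + 4 * Real.pi * |C|) * Real.exp ((N + 1 : ℕ) * s)) := by gcongr
      _ = _ := by ring
  change Φ s ≤ _
  rw [hΦeq]
  nlinarith [le_abs_self (Φ 0), abs_nonneg (Φ 0)]

end

/-! ### Entire functions with real part of polynomial mean growth -/

/-- ∂̄F = 0, so the area term of Green's formula vanishes. -/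
theorem integral_eq_of_periodic_of_differentiable {F : ℂ → ℂ} (hF : Differentiable ℂ F)
    (hper : ∀ w, F (w + 2 * Real.pi * Complex.I) = F w) (s : ℝ) :
    ∫ y in (0 : ℝ)..2 * Real.pi, F (s + y * Complex.I) =
      ∫ y in (0 : ℝ)..2 * Real.pi, F (y * Complex.I) := by
  have hval : ∀ w, Complex.I * (deriv F w • (1 : ℂ →L[ℝ] ℂ)) 1 -
      (deriv F w • (1 : ℂ →L[ℝ] ℂ)) Complex.I = 0 := by
    intro w
    simp
    ring
  have h := integral_sub_of_periodic (fun w => (hF w).hasDerivAt.complexToReal_fderiv)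
    (by simp only [hval]; fun_prop) hper s
  simp only [hval] at h
  simpa [sub_eq_zero] using h

/-- Test 2 Re g = g + conj g against exp(-kw) on Re w = s. The part from g is independent of s, the
conjugate part decays like exp(-2ks), and the whole integral is O(exp((N - k)s)). Letting s → ∞
kills the coefficient. -/
theorem fourier_coeff_eq_zero_of_integral_abs_re_le {g : ℂ → ℂ} (hg : Differentiable ℂ g)
    {K : ℝ} {N : ℕ} (h : ∀ s : ℝ, 0 ≤ s →
      ∫ y in (0 : ℝ)..2 * Real.pi, |(g (Complex.exp (s + y * Complex.I))).re| ≤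
        K * Real.exp (N * s)) {k : ℕ} (hk : N < k) :
    ∫ y in (0 : ℝ)..2 * Real.pi,
      g (Complex.exp (y * Complex.I)) * Complex.exp (-(k * (y * Complex.I))) = 0 := by
  have hpi := Real.pi_pos
  have hgc := hg.continuous
  set A := ∫ y in (0 : ℝ)..2 * Real.pi,
    g (Complex.exp (y * Complex.I)) * Complex.exp (-(k * (y * Complex.I))) with hA
  set B := ∫ y in (0 : ℝ)..2 * Real.pi,
    g (Complex.exp (y * Complex.I)) * Complex.exp (k * (y * Complex.I)) with hB
  have hexp : ∀ w, Complex.exp (w + 2 * Real.pi * Complex.I) = Complex.exp w :=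
    Complex.exp_periodic
  have hexpk : ∀ w, Complex.exp (k * (w + 2 * Real.pi * Complex.I)) = Complex.exp (k * w) := by
    intro w
    rw [Complex.exp_nat_mul, hexp, ← Complex.exp_nat_mul]
  have hA' : ∀ s : ℝ, ∫ y in (0 : ℝ)..2 * Real.pi, g (Complex.exp (s + y * Complex.I)) *
      Complex.exp (-(k * (s + y * Complex.I))) = A := fun s =>
    integral_eq_of_periodic_of_differentiable
      (F := fun w => g (Complex.exp w) * Complex.exp (-(k * w))) (by fun_prop)
      (fun w => by simp only [hexp, hexpk, Complex.exp_neg]) s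
  have hB' : ∀ s : ℝ, ∫ y in (0 : ℝ)..2 * Real.pi, g (Complex.exp (s + y * Complex.I)) *
      Complex.exp (k * (s + y * Complex.I)) = B := fun s =>
    integral_eq_of_periodic_of_differentiable
      (F := fun w => g (Complex.exp w) * Complex.exp (k * w)) (by fun_prop)
      (fun w => by simp only [hexp, hexpk]) s
  have hsum : ∀ s : ℝ, ∫ y in (0 : ℝ)..2 * Real.pi,
      ((2 * (g (Complex.exp (s + y * Complex.I))).re : ℝ) : ℂ) *
        Complex.exp (-(k * (s + y * Complex.I))) =
      A + Complex.exp (-(2 * k * s)) * (starRingEnd ℂ) B := by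
    intro s
    rw [← hA' s, ← hB' s, ← intervalIntegral.intervalIntegral_conj,
      ← intervalIntegral.integral_const_mul, ← intervalIntegral.integral_add]
    · congr 1
      funext y
      rw [map_mul, ← Complex.exp_conj, mul_left_comm, ← Complex.exp_add]
      have : -(2 * k * s : ℂ) + (starRingEnd ℂ) (k * (s + y * Complex.I)) =
          -(k * (s + y * Complex.I)) := by
        simp
        ring
      rw [this, ← add_mul, Complex.add_conj]
    · exact Continuous.intervalIntegrable (by fun_prop) _ _
    · exact Continuous.intervalIntegrable (by fun_prop) _ _
  have hbound : ∀ s : ℝ, 0 ≤ s → ‖A‖ ≤ (2 * |K| + ‖B‖) * Real.exp (-s) := by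
    intro s hs
    have hk1 : (N : ℝ) + 1 ≤ k := by exact_mod_cast hk
    have hN : (0 : ℝ) ≤ N := N.cast_nonneg
    have h1 : ‖A + Complex.exp (-(2 * k * s)) * (starRingEnd ℂ) B‖ ≤
        2 * |K| * Real.exp (-s) := by
      rw [← hsum]
      refine (intervalIntegral.norm_integral_le_integral_norm (by positivity)).trans ?_
      have h2 : ∀ y : ℝ, ‖((2 * (g (Complex.exp (s + y * Complex.I))).re : ℝ) : ℂ) *
          Complex.exp (-(k * (s + y * Complex.I)))‖ =
          2 * Real.exp (-(k * s)) * |(g (Complex.exp (s + y * Complex.I))).re| := by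
        intro y
        rw [norm_mul, Complex.norm_real, Complex.norm_exp, Real.norm_eq_abs, abs_mul, abs_two]
        simp
        ring
      simp only [h2, intervalIntegral.integral_const_mul]
      calc _ ≤ 2 * Real.exp (-(k * s)) * (|K| * Real.exp (N * s)) := by
            refine mul_le_mul_of_nonneg_left ((h s hs).trans ?_) (by positivity)
            exact mul_le_mul_of_nonneg_right (le_abs_self K) (Real.exp_pos _).le
        _ = 2 * |K| * Real.exp (-(k * s) + N * s) := by rw [Real.exp_add]; ring
        _ ≤ _ := by
            gcongr
            nlinarith
    have h3 : ‖Complex.exp (-(2 * k * s)) * (starRingEnd ℂ) B‖ ≤ ‖B‖ * Real.exp (-s) := by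
      rw [norm_mul, RCLike.norm_conj, Complex.norm_exp, mul_comm]
      gcongr
      simp
      nlinarith
    calc ‖A‖ = ‖(A + Complex.exp (-(2 * k * s)) * (starRingEnd ℂ) B) -
          Complex.exp (-(2 * k * s)) * (starRingEnd ℂ) B‖ := by rw [add_sub_cancel_right]
      _ ≤ _ := norm_sub_le _ _
      _ ≤ _ := by rw [add_mul]; exact add_le_add h1 h3
  have hlim : Filter.Tendsto (fun s : ℝ => (2 * |K| + ‖B‖) * Real.exp (-s)) Filter.atTop (𝓝 0) := by
    simpa using (Real.tendsto_exp_neg_atTop_nhds_zero).const_mul (2 * |K| + ‖B‖)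
  have h0 : ‖A‖ ≤ 0 := ge_of_tendsto hlim
    (Filter.eventually_atTop.2 ⟨0, hbound⟩)
  exact norm_le_zero_iff.1 h0

/-- An entire function whose real part has circular `L¹` means of polynomial growth is a
polynomial. -/
theorem exists_polynomial_of_integral_abs_re_le {g : ℂ → ℂ} (hg : Differentiable ℂ g)
    {K : ℝ} {N : ℕ} (h : ∀ s : ℝ, 0 ≤ s →
      ∫ y in (0 : ℝ)..2 * Real.pi, |(g (Complex.exp (s + y * Complex.I))).re| ≤
        K * Real.exp (N * s)) :
    ∃ p : Polynomial ℂ, ∀ z, g z = p.eval z := by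
  have hps := hg.hasFPowerSeriesOnBall 0 (R := 1) one_pos
  set q := cauchyPowerSeries g 0 ((1 : NNReal) : ℝ) with hq
  -- The Cauchy coefficients on the unit circle are, up to a constant, the Fourier integrals over
  -- the line Re w = 0.
  have hcoeff : ∀ k, N < k → q.coeff k = 0 := by
    intro k hk
    have h0 := fourier_coeff_eq_zero_of_integral_abs_re_le hg h hk
    rw [FormalMultilinearSeries.coeff, hq]
    change cauchyPowerSeries g 0 _ k (fun _ => 1) = 0
    rw [cauchyPowerSeries_apply, circleIntegral]
    refine smul_eq_zero_of_right _ ?_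
    have h1 : ∀ y : ℝ, deriv (circleMap 0 ((1 : NNReal) : ℝ)) y •
        ((1 / (circleMap 0 ((1 : NNReal) : ℝ) y - 0)) ^ k •
          (circleMap 0 ((1 : NNReal) : ℝ) y - 0)⁻¹ • g (circleMap 0 ((1 : NNReal) : ℝ) y)) =
        Complex.I * (g (Complex.exp (y * Complex.I)) *
          Complex.exp (-(k * (y * Complex.I)))) := by
      intro y
      have hne := Complex.exp_ne_zero (y * Complex.I)
      simp [circleMap, Complex.exp_neg, Complex.exp_nat_mul]
      field_simp
    simp only [h1, intervalIntegral.integral_const_mul, h0, mul_zero]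
  refine ⟨∑ k ∈ Finset.range (N + 1), Polynomial.C (q.coeff k) * Polynomial.X ^ k, fun z => ?_⟩
  have h1 : HasSum (fun k => z ^ k • q.coeff k) (g z) := by
    have := hps.hasSum (y := z) (by simp)
    rw [zero_add] at this
    convert! this using 2 with k
    exact FormalMultilinearSeries.apply_eq_pow_smul_coeff.symm
  have h2 := hasSum_sum_of_ne_finset_zero (L := SummationFilter.unconditional ℕ)
    (f := fun k => z ^ k • q.coeff k) (s := Finset.range (N + 1)) (fun k hk => by
      rw [hcoeff k (by simpa using hk), smul_zero])
  rw [h1.unique h2, Polynomial.eval_finsetSum]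
  refine Finset.sum_congr rfl fun k _ => ?_
  rw [Polynomial.eval_mul, Polynomial.eval_C, Polynomial.eval_pow, Polynomial.eval_X, smul_eq_mul,
    mul_comm]

/-! ### The logarithms are polynomials -/

section

variable {ι : Type*} [Fintype ι]

/-- The substitution z = exp w turns circles into vertical period segments; by the chain rule every
derivative acquires the common factor exp w. -/
theorem derivVar_comp_exp {g : ι → ℂ → ℂ} (hg : ∀ i, Differentiable ℂ (g i)) (w : ℂ) :
    derivVar (fun i w => g i (Complex.exp w)) w =
      Real.exp w.re ^ 2 * derivVar g (Complex.exp w) := by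
  have hd : ∀ i, deriv (fun w => g i (Complex.exp w)) w =
      deriv (g i) (Complex.exp w) * Complex.exp w := fun i =>
    ((hg i _).hasDerivAt.comp w (Complex.hasDerivAt_exp w)).deriv
  have hm : derivMean (fun i w => g i (Complex.exp w)) w =
      derivMean g (Complex.exp w) * Complex.exp w := by
    simp only [derivMean, hd, Finset.sum_mul, mul_assoc]
    rfl
  rw [derivVar, hm, derivVar, mul_sub, Finset.mul_sum]
  congr 1
  · refine Finset.sum_congr rfl fun i _ => ?_
    rw [hd, norm_mul, mul_pow, Complex.norm_exp]
    simp only [expWeight]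
    ring
  · rw [norm_mul, mul_pow, Complex.norm_exp, mul_comm]

theorem two_mul_re_le_logSumExp (h : ι → ℂ → ℂ) (i : ι) (w : ℂ) :
    2 * (h i w).re ≤ logSumExp h w := by
  rw [logSumExp, Real.le_log_iff_exp_le
    (Finset.sum_pos (fun _ _ => Real.exp_pos _) ⟨i, Finset.mem_univ i⟩)]
  exact Finset.single_le_sum (f := fun i => Real.exp (2 * (h i w).re))
    (fun _ _ => (Real.exp_pos _).le) (Finset.mem_univ i)

/-- L dominates 2 Re hᵢ and, because of the index `i₀`, also 0; hence |Re hᵢ| ≤ L - Re hᵢ. The mean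
of Re hᵢ is constant and that of L grows polynomially. -/
theorem exists_polynomial_of_derivVar_le {g : ι → ℂ → ℂ} (hg : ∀ i, Differentiable ℂ (g i))
    {i₀ : ι} (h0 : ∀ z, g i₀ z = 0) {C : ℝ} {m : ℕ}
    (hV : ∀ z : ℂ, 1 ≤ ‖z‖ → derivVar g z ≤ C * ‖z‖ ^ m) (i : ι) :
    ∃ p : Polynomial ℂ, ∀ z, g i z = p.eval z := by
  have : Nonempty ι := ⟨i₀⟩
  set h : ι → ℂ → ℂ := fun i w => g i (Complex.exp w) with hh
  have hd : ∀ i, Differentiable ℂ (h i) := fun i => (hg i).comp Complex.differentiable_exp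
  have hper : ∀ i w, h i (w + 2 * Real.pi * Complex.I) = h i w := fun i w =>
    congrArg (g i) (Complex.exp_periodic w)
  -- The 2 in `m + 2` is the factor |z|² from the substitution z = exp w.
  obtain ⟨K, hK, hJ⟩ := integral_logSumExp_le hd hper (C := C) (N := m + 2) (fun w hw => by
    rw [hh, derivVar_comp_exp hg]
    have h1 := hV (Complex.exp w) (by rw [Complex.norm_exp]; exact Real.one_le_exp hw)
    rw [Complex.norm_exp] at h1
    calc _ ≤ Real.exp w.re ^ 2 * (C * Real.exp w.re ^ m) := by gcongr
      _ = _ := by rw [Real.exp_nat_mul]; ring)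
  set D := ∫ y in (0 : ℝ)..2 * Real.pi, h i (y * Complex.I) with hD
  refine exists_polynomial_of_integral_abs_re_le (hg i) (K := K + |D.re|) (N := m + 2 + 2)
    fun s hs => ?_
  have hgc := (hg i).continuous
  have hhc := (hd i).continuous
  have hLc := continuous_logSumExp hd
  have hre : ∫ y in (0 : ℝ)..2 * Real.pi, (h i (s + y * Complex.I)).re = D.re := by
    rw [hD, ← integral_eq_of_periodic_of_differentiable (hd i) (hper i) s]
    exact Complex.reCLM.intervalIntegral_comp_comm (Continuous.intervalIntegrable (by fun_prop) _ _)
  calc ∫ y in (0 : ℝ)..2 * Real.pi, |(h i (s + y * Complex.I)).re|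
      ≤ ∫ y in (0 : ℝ)..2 * Real.pi,
          (logSumExp h (s + y * Complex.I) - (h i (s + y * Complex.I)).re) := by
        refine intervalIntegral.integral_mono_on (by positivity)
          (Continuous.intervalIntegrable (by fun_prop) _ _)
          (Continuous.intervalIntegrable (by fun_prop) _ _) fun y _ => ?_
        have h1 := two_mul_re_le_logSumExp h i (s + y * Complex.I)
        have h2 := two_mul_re_le_logSumExp h i₀ (s + y * Complex.I)
        simp only [hh, h0, Complex.zero_re, mul_zero] at h1 h2 ⊢
        rw [abs_le]
        constructor <;> linarith
    _ = (∫ y in (0 : ℝ)..2 * Real.pi, logSumExp h (s + y * Complex.I)) - D.re := by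
        rw [← hre]
        exact intervalIntegral.integral_sub (Continuous.intervalIntegrable (by fun_prop) _ _)
          (Continuous.intervalIntegrable (by fun_prop) _ _)
    _ ≤ K * Real.exp ((m + 2 + 2 : ℕ) * s) + |D.re| * 1 := by
        linarith [hJ s hs, neg_abs_le D.re]
    _ ≤ K * Real.exp ((m + 2 + 2 : ℕ) * s) + |D.re| * Real.exp ((m + 2 + 2 : ℕ) * s) := by
        gcongr
        exact Real.one_le_exp (by positivity)
    _ = _ := by ring

end

/-! ### Polynomials on large circles -/

theorem Polynomial.exists_norm_eval_le {q : Polynomial ℂ} {m : ℕ} (hq : q.natDegree ≤ m) :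
    ∃ K, 0 ≤ K ∧ ∀ z : ℂ, 1 ≤ ‖z‖ → ‖q.eval z‖ ≤ K * ‖z‖ ^ m := by
  refine ⟨∑ k ∈ Finset.range (m + 1), ‖q.coeff k‖, by positivity, fun z hz => ?_⟩
  rw [Polynomial.eval_eq_sum_range' (Nat.lt_succ_of_le hq), Finset.sum_mul]
  refine (norm_sum_le _ _).trans (Finset.sum_le_sum fun k hk => ?_)
  rw [norm_mul, norm_pow]
  gcongr
  exact Nat.lt_succ_iff.1 (Finset.mem_range.1 hk)

/-- Uniform in the argument of z, with the filter on the radius alone, so that finitely many such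
estimates hold on one circle. -/
theorem Polynomial.eventually_norm_eval_sub_le {q : Polynomial ℂ} (hq : q ≠ 0) :
    ∀ᶠ r : ℝ in Filter.atTop, ∀ z : ℂ, ‖z‖ = r →
      ‖q.eval z - q.leadingCoeff * z ^ q.natDegree‖ ≤
        ‖q.leadingCoeff‖ / 2 * ‖z‖ ^ q.natDegree := by
  have ha : 0 < ‖q.leadingCoeff‖ := norm_pos_iff.2 (Polynomial.leadingCoeff_ne_zero.2 hq)
  have hsub : ∀ z, q.eval z - q.leadingCoeff * z ^ q.natDegree = q.eraseLead.eval z := by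
    intro z
    have h := congrArg (Polynomial.eval z) q.eraseLead_add_C_mul_X_pow
    simp only [Polynomial.eval_add, Polynomial.eval_mul, Polynomial.eval_C, Polynomial.eval_pow,
      Polynomial.eval_X] at h
    linear_combination -h
  rcases q.eraseLead_natDegree_lt_or_eraseLead_eq_zero with h | h
  · obtain ⟨K, hK, hb⟩ := Polynomial.exists_norm_eval_le (Nat.le_sub_one_of_lt h)
    filter_upwards [Filter.eventually_ge_atTop (max 1 (2 * K / ‖q.leadingCoeff‖))]
      with r hr z hz
    subst hz
    rw [hsub]
    refine (hb z ((le_max_left _ _).trans hr)).trans ?_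
    have h1 := (le_max_right _ _).trans hr
    rw [div_le_iff₀ ha] at h1
    obtain ⟨d, hd⟩ : ∃ d, q.natDegree = d + 1 := ⟨q.natDegree - 1, by omega⟩
    rw [hd, Nat.add_sub_cancel, pow_succ, mul_comm (‖z‖ ^ d), ← mul_assoc]
    gcongr
    linarith
  · refine Filter.Eventually.of_forall fun r z _ => ?_
    rw [hsub, h]
    simp
    positivity

theorem Polynomial.eventually_le_norm_eval {q : Polynomial ℂ} (hq : q ≠ 0) :
    ∀ᶠ r : ℝ in Filter.atTop, ∀ z : ℂ, ‖z‖ = r →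
      ‖q.leadingCoeff‖ / 2 * ‖z‖ ^ q.natDegree ≤ ‖q.eval z‖ := by
  filter_upwards [Polynomial.eventually_norm_eval_sub_le hq] with r hr z hz
  have h1 := hr z hz
  have h2 := norm_sub_norm_le (q.leadingCoeff * z ^ q.natDegree) (q.eval z)
  rw [norm_sub_rev, norm_mul, norm_pow] at h2
  linarith

/-- Choose u with c·u^d = |c|: on this ray the leading term is positive and dominates. The direction
depends only on c and d, not on q. -/
theorem Polynomial.exists_forall_eventually_re_eval_pos {c : ℂ} (hc : c ≠ 0) {d : ℕ} (hd : 0 < d) :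
    ∃ u : ℂ, ‖u‖ = 1 ∧ ∀ q : Polynomial ℂ, q.natDegree = d → q.leadingCoeff = c →
      ∀ᶠ r : ℝ in Filter.atTop, 0 < (q.eval (r * u)).re := by
  have ha : 0 < ‖c‖ := norm_pos_iff.2 hc
  obtain ⟨u, hu⟩ := IsAlgClosed.exists_pow_nat_eq ((‖c‖ : ℂ) / c) hd
  have hun : ‖u‖ = 1 := by
    have h1 := congrArg norm hu
    rw [norm_pow, norm_div, Complex.norm_real, norm_norm, div_self ha.ne'] at h1
    exact (pow_eq_one_iff_of_nonneg (norm_nonneg u) hd.ne').1 h1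
  refine ⟨u, hun, ?_⟩
  rintro q rfl rfl
  filter_upwards [Polynomial.eventually_norm_eval_sub_le (leadingCoeff_ne_zero.1 hc),
    Filter.eventually_gt_atTop 0] with r hr hr0
  have hz : ‖(r : ℂ) * u‖ = r := by
    rw [norm_mul, hun, mul_one, Complex.norm_real, Real.norm_of_nonneg hr0.le]
  have h1 := (abs_le.1 ((Complex.abs_re_le_norm _).trans (hr _ hz))).1
  have h2 : q.leadingCoeff * ((r : ℂ) * u) ^ q.natDegree =
      ((‖q.leadingCoeff‖ * r ^ q.natDegree : ℝ) : ℂ) := by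
    rw [mul_pow, hu]
    push_cast
    field_simp
  rw [h2, hz, Complex.sub_re, Complex.ofReal_re] at h1
  have : 0 < ‖q.leadingCoeff‖ * r ^ q.natDegree := by positivity
  linarith

/-! ### Variance at common maximizers and the degree bound -/

section

variable {ι : Type*} [Fintype ι]

theorem derivVar_eq_sum [Nonempty ι] (g : ι → ℂ → ℂ) (z : ℂ) :
    derivVar g z = ∑ i, expWeight g i z * ‖deriv (g i) z - derivMean g z‖ ^ 2 := by
  set P := derivMean g z with hP
  have h1 : ∀ i, expWeight g i z * ‖deriv (g i) z - P‖ ^ 2 =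
      expWeight g i z * ‖deriv (g i) z‖ ^ 2 + expWeight g i z * ‖P‖ ^ 2 -
        2 * (((expWeight g i z : ℂ) * deriv (g i) z) * (starRingEnd ℂ) P).re := by
    intro i
    rw [mul_assoc (expWeight g i z : ℂ), Complex.re_ofReal_mul]
    simp only [← Complex.normSq_eq_norm_sq, Complex.normSq_sub]
    ring
  have h2 : ∑ i, (((expWeight g i z : ℂ) * deriv (g i) z) * (starRingEnd ℂ) P).re = ‖P‖ ^ 2 := by
    rw [← Complex.re_sum, ← Finset.sum_mul]
    change (P * _).re = _
    rw [Complex.mul_conj, Complex.ofReal_re, Complex.normSq_eq_norm_sq]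
  simp only [h1, Finset.sum_sub_distrib, Finset.sum_add_distrib, ← Finset.mul_sum, h2,
    ← Finset.sum_mul, sum_expWeight, derivVar, ← hP]
  ring

theorem derivVar_le_sum [Nonempty ι] (g : ι → ℂ → ℂ) (z : ℂ) :
    derivVar g z ≤ ∑ i, ‖deriv (g i) z‖ ^ 2 := by
  refine (sub_le_self _ (sq_nonneg _)).trans (Finset.sum_le_sum fun i _ => ?_)
  refine mul_le_of_le_one_left (sq_nonneg _) ?_
  rw [← sum_expWeight g z]
  exact Finset.single_le_sum (f := fun i => expWeight g i z)
    (fun i _ => (expWeight_pos g i z).le) (Finset.mem_univ i)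

theorem inv_card_le_expWeight [Nonempty ι] {g : ι → ℂ → ℂ} {i : ι} {z : ℂ}
    (hi : ∀ k, (g k z).re ≤ (g i z).re) : (Fintype.card ι : ℝ)⁻¹ ≤ expWeight g i z := by
  rw [expWeight, le_div_iff₀ (sum_exp_pos g z), inv_mul_le_iff₀ (by positivity)]
  calc ∑ j, Real.exp (2 * (g j z).re) ≤ ∑ _j : ι, Real.exp (2 * (g i z).re) :=
        Finset.sum_le_sum fun j _ => Real.exp_le_exp.2 (by linarith [hi j])
    _ = _ := by simp

/-- Both maximizers carry weight at least 1/card; keep their two terms of the variance and use |x -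
y|² ≤ 2(|x - P|² + |y - P|²). -/
theorem norm_sub_sq_le_derivVar [Nonempty ι] {g : ι → ℂ → ℂ} {i j : ι} (hij : i ≠ j) {z : ℂ}
    (hi : ∀ k, (g k z).re ≤ (g i z).re) (hj : ∀ k, (g k z).re ≤ (g j z).re) :
    ‖deriv (g i) z - deriv (g j) z‖ ^ 2 ≤ 2 * Fintype.card ι * derivVar g z := by
  classical
  have hN : (0 : ℝ) < Fintype.card ι := by positivity
  set P := derivMean g z
  have h1 : expWeight g i z * ‖deriv (g i) z - P‖ ^ 2 +
      expWeight g j z * ‖deriv (g j) z - P‖ ^ 2 ≤ derivVar g z := by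
    rw [derivVar_eq_sum, ← Finset.sum_pair
      (f := fun i => expWeight g i z * ‖deriv (g i) z - P‖ ^ 2) hij]
    exact Finset.sum_le_sum_of_subset_of_nonneg (Finset.subset_univ _)
      fun i _ _ => mul_nonneg (expWeight_pos g i z).le (sq_nonneg _)
  have h2 : (Fintype.card ι : ℝ)⁻¹ * (‖deriv (g i) z - P‖ ^ 2 + ‖deriv (g j) z - P‖ ^ 2) ≤
      derivVar g z := by
    refine le_trans ?_ h1
    rw [mul_add]
    gcongr
    · exact inv_card_le_expWeight hi
    · exact inv_card_le_expWeight hj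
  rw [inv_mul_le_iff₀ hN] at h2
  have h3 : ‖deriv (g i) z - deriv (g j) z‖ ≤ ‖deriv (g i) z - P‖ + ‖deriv (g j) z - P‖ := by
    rw [← sub_sub_sub_cancel_right _ _ P]
    exact norm_sub_le _ _
  have h4 := norm_nonneg (deriv (g i) z - deriv (g j) z)
  nlinarith [sq_nonneg (‖deriv (g i) z - P‖ - ‖deriv (g j) z - P‖)]

/-- If polynomials have different coefficients in their top degree `d`, then on every large circle
two of them with different coefficients maximize the real part at a common point. -/
theorem eventually_exists_common_maximizers {p : ι → Polynomial ℂ} {d : ℕ} (hd : 0 < d)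
    (hp : ∀ i, (p i).natDegree ≤ d) {i₀ j₀ : ι} (hne : (p i₀).coeff d ≠ (p j₀).coeff d) :
    ∀ᶠ r : ℝ in Filter.atTop, ∃ z : ℂ, ‖z‖ = r ∧ ∃ i j, (p i).coeff d ≠ (p j).coeff d ∧
      (∀ k, ((p k).eval z).re ≤ ((p i).eval z).re) ∧
      (∀ k, ((p k).eval z).re ≤ ((p j).eval z).re) := by
  have : Nonempty ι := ⟨i₀⟩
  choose! u hu1 hu using fun (c : ℂ) (hc : c ≠ 0) =>
    Polynomial.exists_forall_eventually_re_eval_pos hc hd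
  -- On the ray attached to the difference b - a, every polynomial with coefficient b beats every
  -- one with coefficient a.
  have hev : ∀ᶠ r : ℝ in Filter.atTop, ∀ i j, (p j).coeff d - (p i).coeff d ≠ 0 →
      ((p i).eval (r * u ((p j).coeff d - (p i).coeff d))).re <
        ((p j).eval (r * u ((p j).coeff d - (p i).coeff d))).re := by
    refine Filter.eventually_all.2 fun i => Filter.eventually_all.2 fun j => ?_
    by_cases hij : (p j).coeff d - (p i).coeff d = 0
    · exact Filter.Eventually.of_forall fun r h => absurd hij h
    have hdeg : (p j - p i).natDegree = d := by
      refine Polynomial.natDegree_eq_of_le_of_coeff_ne_zero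
        ((Polynomial.natDegree_sub_le _ _).trans (max_le (hp j) (hp i))) ?_
      rwa [Polynomial.coeff_sub]
    filter_upwards [hu _ hij (p j - p i) hdeg
      (by rw [Polynomial.leadingCoeff, hdeg, Polynomial.coeff_sub])] with r hr _
    rw [Polynomial.eval_sub, Complex.sub_re] at hr
    linarith
  filter_upwards [hev, Filter.eventually_gt_atTop 0] with r hr hr0
  set F : ι → Set ℂ := fun i => {z | ∀ k, ((p k).eval z).re ≤ ((p i).eval z).re} with hF
  have hFc : ∀ i, IsClosed (F i) := by
    intro i
    simp only [hF, Set.ofPred_forall]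
    refine isClosed_iInter fun k => isClosed_le ?_ ?_
    · exact Complex.continuous_re.comp (p k).continuous
    · exact Complex.continuous_re.comp (p i).continuous
  have hmax : ∀ z, ∃ i, z ∈ F i := fun z => Finite.exists_max fun i => ((p i).eval z).re
  obtain ⟨i₁, hi₁⟩ := hmax r
  set a := (p i₁).coeff d
  obtain ⟨j, hj⟩ : ∃ j, (p j).coeff d ≠ a := by
    by_cases h : (p i₀).coeff d = a
    · exact ⟨j₀, fun h' => hne (h.trans h'.symm)⟩
    · exact ⟨i₀, h⟩
  have hS : IsPreconnected (Metric.sphere (0 : ℂ) r) :=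
    isPreconnected_sphere (by rw [Complex.rank_real_complex]; norm_num) 0 r
  -- The circle is covered by two closed sets: points with a maximizer of coefficient a, and points
  -- with a maximizer of another coefficient. The first contains r; the second contains the point on
  -- the ray for `(p j).coeff d - a`, where `p j` beats everything with coefficient a. By
  -- connectedness they meet.
  obtain ⟨z, hz, hzA, hzB⟩ := isPreconnected_closed_iff.1 hS
    (⋃ i ∈ {i | (p i).coeff d = a}, F i) (⋃ i ∈ {i | (p i).coeff d ≠ a}, F i)
    ((Set.toFinite _).isClosed_biUnion fun i _ => hFc i)
    ((Set.toFinite _).isClosed_biUnion fun i _ => hFc i)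
    (fun z _ => by
      obtain ⟨i, hi⟩ := hmax z
      by_cases h : (p i).coeff d = a
      · exact Or.inl (Set.mem_biUnion h hi)
      · exact Or.inr (Set.mem_biUnion h hi))
    ⟨r, by simp [hr0.le], Set.mem_biUnion rfl hi₁⟩
    (by
      refine ⟨r * u ((p j).coeff d - a), ?_, ?_⟩
      · simp [hu1 _ (sub_ne_zero.2 hj), hr0.le]
      · obtain ⟨i, hi⟩ := hmax (r * u ((p j).coeff d - a))
        refine Set.mem_biUnion (fun h : (p i).coeff d = a => ?_) hi
        have h1 := hr i j (by rw [h]; exact sub_ne_zero.2 hj)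
        rw [h] at h1
        exact (hi j).not_gt h1)
  simp only [Set.mem_iUnion] at hzA hzB
  obtain ⟨i, hia, hi⟩ := hzA
  obtain ⟨k, hka, hk⟩ := hzB
  exact ⟨z, by simpa using hz, i, k, fun h => hka (h.symm.trans hia), hi, hk⟩

/-- The growth of `derivVar` bounds the degrees of the polynomials. -/
theorem natDegree_le_of_derivVar_le {p : ι → Polynomial ℂ} {i₀ : ι} (h0 : p i₀ = 0)
    {lam K : ℝ} (hV : ∀ z : ℂ, 1 ≤ ‖z‖ →
      derivVar (fun i z => (p i).eval z) z ≤ K * (‖z‖ ^ lam) ^ 2) (i : ι) :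
    (p i).natDegree ≤ ⌊lam⌋₊ + 1 := by
  have : Nonempty ι := ⟨i₀⟩
  obtain ⟨j₀, hj₀⟩ := Finite.exists_max fun i => (p i).natDegree
  refine (hj₀ i).trans ?_
  by_contra! hlt
  set d := (p j₀).natDegree with hd
  -- The zero polynomial `p i₀` supplies a second coefficient in degree d.
  have hne : (p i₀).coeff d ≠ (p j₀).coeff d := by
    have : p j₀ ≠ 0 := fun h => by simp [hd, h] at hlt
    rw [h0, Polynomial.coeff_zero]
    exact (Polynomial.leadingCoeff_ne_zero.2 this).symm
  have hdeg : ∀ i j, (p i).coeff d ≠ (p j).coeff d →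
      (p i - p j).derivative.natDegree = d - 1 := by
    intro i j hij
    rw [Polynomial.natDegree_derivative]
    congr 1
    refine Polynomial.natDegree_eq_of_le_of_coeff_ne_zero
      ((Polynomial.natDegree_sub_le _ _).trans (max_le (hj₀ i) (hj₀ j))) ?_
    rwa [Polynomial.coeff_sub, sub_ne_zero]
  -- One constant for all pairs: the minimum over the finite set ι × ι.
  have hlow : ∃ c : ℝ, 0 < c ∧ ∀ᶠ r : ℝ in Filter.atTop, ∀ i j, (p i).coeff d ≠ (p j).coeff d →
      ∀ z : ℂ, ‖z‖ = r → c * ‖z‖ ^ (d - 1) ≤ ‖(p i - p j).derivative.eval z‖ := by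
    have hij : ∀ x : ι × ι, ∃ c : ℝ, 0 < c ∧ ∀ᶠ r : ℝ in Filter.atTop,
        (p x.1).coeff d ≠ (p x.2).coeff d →
        ∀ z : ℂ, ‖z‖ = r → c * ‖z‖ ^ (d - 1) ≤ ‖(p x.1 - p x.2).derivative.eval z‖ := by
      intro x
      by_cases h : (p x.1).coeff d = (p x.2).coeff d
      · exact ⟨1, one_pos, Filter.Eventually.of_forall fun r h' => absurd h h'⟩
      have hq : (p x.1 - p x.2).derivative ≠ 0 := fun h' => by
        have := hdeg _ _ h
        rw [h', Polynomial.natDegree_zero] at this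
        omega
      refine ⟨_, half_pos (norm_pos_iff.2 (Polynomial.leadingCoeff_ne_zero.2 hq)), ?_⟩
      filter_upwards [Polynomial.eventually_le_norm_eval hq] with r hr _ z hz
      rw [← hdeg _ _ h]
      exact hr z hz
    choose c hc hb using hij
    obtain ⟨x₀, hx₀⟩ := Finite.exists_min c
    refine ⟨c x₀, hc x₀, ?_⟩
    filter_upwards [Filter.eventually_all.2 hb] with r hr i j hij z hz
    refine le_trans ?_ (hr (i, j) hij z hz)
    gcongr
    exact hx₀ _
  obtain ⟨c, hc, hlow⟩ := hlow
  set M := 2 * Fintype.card ι * K with hM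
  -- Integrality enters here: d - 1 ≥ ⌊lam⌋₊ + 1 exceeds `lam` strictly, so the lower bound outgrows
  -- the assumed upper bound.
  have hgrow : Filter.Tendsto (fun r : ℝ => c ^ 2 * (r ^ ((⌊lam⌋₊ + 1 : ℕ) - lam)) ^ 2)
      Filter.atTop Filter.atTop := by
    refine Filter.Tendsto.const_mul_atTop (by positivity)
      ((Filter.tendsto_pow_atTop two_ne_zero).comp (tendsto_rpow_atTop ?_))
    push_cast
    linarith [Nat.lt_floor_add_one lam]
  obtain ⟨r, hr, ⟨z, hz, i, j, hij, hi, hj⟩, hr1, hrM⟩ :=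
    (hlow.and ((eventually_exists_common_maximizers (p := p) (d := d) (by omega) hj₀ hne).and
      ((Filter.eventually_ge_atTop 1).and (hgrow.eventually_gt_atTop M)))).exists
  have hr0 : 0 < r := by linarith
  have h1 := hr i j hij z hz
  have h2 := norm_sub_sq_le_derivVar (g := fun i z => (p i).eval z)
    (show i ≠ j from fun h => hij (by rw [h])) hi hj
  simp only [Polynomial.deriv] at h2
  rw [← Polynomial.eval_sub, ← Polynomial.derivative_sub] at h2
  have h3 := hV z (by rw [hz]; exact hr1)
  rw [hz] at h1 h3
  have h4 : c * (r ^ ((⌊lam⌋₊ + 1 : ℕ) - lam) * r ^ lam) ≤ c * r ^ (d - 1) := by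
    rw [← Real.rpow_add hr0, sub_add_cancel, Real.rpow_natCast]
    gcongr
    omega
  have h5 : (c * (r ^ ((⌊lam⌋₊ + 1 : ℕ) - lam) * r ^ lam)) ^ 2 ≤ M * (r ^ lam) ^ 2 := by
    calc _ ≤ ‖(p i - p j).derivative.eval z‖ ^ 2 := by
          gcongr
          exact h4.trans h1
      _ ≤ _ := h2
      _ ≤ 2 * Fintype.card ι * (K * (r ^ lam) ^ 2) := by gcongr
      _ = _ := by rw [hM]; ring
  have h6 : 0 < (r ^ lam) ^ 2 := by positivity
  have h7 : c ^ 2 * (r ^ ((⌊lam⌋₊ + 1 : ℕ) - lam)) ^ 2 ≤ M := by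
    refine le_of_mul_le_mul_right ?_ h6
    calc _ = (c * (r ^ ((⌊lam⌋₊ + 1 : ℕ) - lam) * r ^ lam)) ^ 2 := by ring
      _ ≤ _ := h5
  exact absurd h7 (not_le.2 hrM)

end

/-! ### Conclusion -/

theorem mainTheorem4 (n : ℕ) (lam : ℝ) (hlam : 0 ≤ lam) (f : ℂ → Torus n)
    (hf : MDifferentiable 𝓘(ℂ, ℂ) 𝓘(ℂ, EuclideanSpace ℂ (Fin n)) f)
    (hgrowth : ∃ C : ℝ, 0 < C ∧ ∀ z : ℂ, 1 ≤ ‖z‖ → dnorm f z ≤ C * ‖z‖ ^ lam) :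
    ∃ C' : ℝ, 0 < C' ∧ ∀ z : ℂ, 1 ≤ ‖z‖ → dnorm f z ≤ C' * ‖z‖ ^ ⌊lam⌋₊ := by
  obtain ⟨C, hC, hgrowth⟩ := hgrowth
  have hF : ∀ i, Differentiable ℂ fun z => torusCoord n (f z) i := fun i z =>
    differentiableAt_euclidean.1 (torusCoord_comp_mdifferentiable hf z) i
  choose g hg hfg using fun i => exists_exp_eq (hF i) fun z => torusCoord_ne_zero (f z) i
  set G : Fin (n + 1) → ℂ → ℂ := Fin.cons 0 g with hG
  have hGd : ∀ i, Differentiable ℂ (G i) := by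
    refine Fin.cases ?_ fun i => ?_
    · exact differentiable_const 0
    · exact hg i
  have hdn : ∀ z, dnorm f z = √(derivVar G z / Real.pi) :=
    dnorm_eq_sqrt_derivVar hf hg fun z i => hfg i z
  have hV : ∀ z : ℂ, 1 ≤ ‖z‖ → derivVar G z ≤ (Real.pi * C ^ 2) * (‖z‖ ^ lam) ^ 2 := by
    intro z hz
    have h1 := hgrowth z hz
    rw [hdn, Real.sqrt_le_left (by positivity), div_le_iff₀ Real.pi_pos] at h1
    linarith
  -- A crude integer exponent suffices for polynomiality; the sharp real one in `hV` is kept for the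
  -- degree bound.
  have hV' : ∀ z : ℂ, 1 ≤ ‖z‖ → derivVar G z ≤ (Real.pi * C ^ 2) * ‖z‖ ^ (⌈lam⌉₊ * 2) := by
    intro z hz
    refine (hV z hz).trans ?_
    rw [pow_mul, ← Real.rpow_natCast ‖z‖]
    gcongr
    exact Nat.le_ceil lam
  choose p hp using exists_polynomial_of_derivVar_le hGd (i₀ := 0) (fun z => rfl) hV'
  have hGp : G = fun i z => (p i).eval z := by
    funext i z
    exact hp i z
  have hp0 : p 0 = 0 := Polynomial.funext fun z => by rw [← hp 0 z, Polynomial.eval_zero]; rfl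
  rw [hGp] at hV hdn
  have hdeg := natDegree_le_of_derivVar_le hp0 hV
  choose K hK hb using fun i => Polynomial.exists_norm_eval_le (q := (p i).derivative)
    (m := ⌊lam⌋₊) ((Polynomial.natDegree_derivative_le _).trans (by have := hdeg i; omega))
  -- The `+ 1` only ensures positivity, as all `K i` may vanish.
  refine ⟨√(∑ i, K i ^ 2 / Real.pi) + 1, by positivity, fun z hz => ?_⟩
  have h1 : derivVar (fun i z => (p i).eval z) z / Real.pi ≤
      (∑ i, K i ^ 2 / Real.pi) * (‖z‖ ^ ⌊lam⌋₊) ^ 2 := by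
    rw [← Finset.sum_div, div_mul_eq_mul_div]
    gcongr
    refine (derivVar_le_sum _ z).trans ?_
    rw [Finset.sum_mul]
    refine Finset.sum_le_sum fun i _ => ?_
    rw [Polynomial.deriv, ← mul_pow]
    gcongr
    exact hb i z hz
  rw [hdn]
  calc _ ≤ √((∑ i, K i ^ 2 / Real.pi) * (‖z‖ ^ ⌊lam⌋₊) ^ 2) := Real.sqrt_le_sqrt h1
    _ = √(∑ i, K i ^ 2 / Real.pi) * ‖z‖ ^ ⌊lam⌋₊ := by
        rw [Real.sqrt_mul' _ (by positivity), Real.sqrt_sq (by positivity)]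
    _ ≤ _ := by gcongr; linarith
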